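/- **Setting.** Consider the linear time-varying system $x_{k+1}=A_kx_k+B_ku_k+G_kd_k+w_k$, $y_k=C_kx_k+v_k$ ($k\ge 0$) with state $x_k\in\mathbb R^{n}$, measurement $y_k\in\mathbb R^{n_y}$, unknown attack $d_k\in\mathbb R^{n_d}$, noise covariances $Q_k\ge 0$ of $w_k$ and $R_k>0$ of $v_k$, and state constraints $\mathcal B_kx_k\le c_k$. The state covariances of the constrained attack-resilient estimation algorithm are defined as follows. Let $P_0^{x,u}\ge 0$ be the initial covariance. For each $k$ let $\bar{\mathcal B}_k$ consist of any selection of rows of $\mathcal B_k$ (in the algorithm: the active constraints), and put $$\bar\Gamma_k=I-P_k^{x,u}\bar{\mathcal B}_k^\top(\bar{\mathcal B}_kP_k^{x,u}\bar{\mathcal B}_k^\top)^{-1}\bar{\mathcal B}_k,\qquad P_k^x=\bar\Gamma_kP_k^{x,u}\bar\Gamma_k^\top .$$ For $k\ge1$, with ${}^\dagger$ the Moore–Penrose inverse, $$\tilde R_k=\big(C_k(A_{k-1}P^x_{k-1}A_{k-1}^\top+Q_{k-1})C_k^\top+R_k\big)^{-1},\quad P^{d,u}_{k-1}=(G_{k-1}^\top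 C_k^\top\tilde R_kC_kG_{k-1})^{-1},$$ $$M_k=P^{d,u}_{k-1}G_{k-1}^\top C_k^\top\tilde R_k,\qquad P^{xd}_{k-1}=-P^x_{k-1}A_{k-1}^\top C_k^\top M_k^\top,$$ $$P_k^{x\star}=A_{k-1}P^x_{k-1}A_{k-1}^\top+A_{k-1}P^{xd}_{k-1}G_{k-1}^\top+G_{k-1}(P^{xd}_{k-1})^\top A_{k-1}^\top+G_{k-1}P^{d,u}_{k-1}G_{k-1}^\top-G_{k-1}M_kC_kQ_{k-1}-Q_{k-1}C_k^\top M_k^\top G_{k-1}^\top+Q_{k-1},$$ $$\tilde R_k^\star=C_kP_k^{x\star}C_k^\top-C_kG_{k-1}M_kR_k-R_kM_k^\top G_{k-1}^\top C_k^\top+R_k,\qquad L_k=(P_k^{x\star}C_k^\top-G_{k-1}M_kR_k)\tilde R_k^{\star\dagger},$$ $$P_k^{x,u}=(I-L_kC_k)G_{k-1}M_kR_kL_k^\top+L_kR_kM_k^\top G_{k-1}^\top(I-L_kC_k)^\top+(I-L_kC_k)P_k^{x\star}(I-L_kC_k)^\top+L_kR_kL_k^\top .$$ Define $$\bar A_{k-1}=(I-G_{k-1}M_kC_k)A_{k-1},\qquad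 \tilde A_{k-1}=\big(I-G_{k-1}M_k(C_kG_{k-1}M_k)^{\dagger}C_k\big)\bar A_{k-1}\bar\Gamma_{k-1},$$ where $(C_kG_{k-1}M_k)^\dagger=(C_kG_{k-1}M_k)^{-1}$ whenever $C_kG_{k-1}M_k$ is invertible. **Uniform detectability.** For a system $x_{k+1}=F_kx_k$, $y_k=H_kx_k$ let $\Phi_{k,k}=I$ and $\Phi_{i,k}=F_{i-1}\cdots F_k$ for $i>k$. The pair $(H,F)$ is uniformly detectable if the sequences $(H_k)$, $(F_k)$ are bounded and there are integers $s,t\ge0$ and constants $0\le\delta<1$, $\beta>0$ such that for all $k\ge 0$ and all $\xi$: if $\|\Phi_{k+t,k}\xi\|\ge \delta\|\xi\|$, then $\xi^\top\big(\sum_{i=k}^{k+s}\Phi_{i,k}^\top H_i^\top H_i\Phi_{i,k}\big)\xi\ge \beta\,\xi^\top\xi$. Detectability of the pair $(C_k,\tilde A_{k-1})$ means detectability of the system $x_k=\tilde A_{k-1}x_{k-1}$, $y_k=C_kx_k$. **Theorem.** Suppose that $A_k,C_k,G_k,Q_k,R_k$ and the gains $M_k$ are bounded uniformly in $k$, and that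 all matrices inverted by ${}^{-1}$ above are invertible. If the pair $(C_k,\tilde A_{k-1})$ is uniformly detectable, then there exist constants $\underline p,\bar p\ge 0$ such that $$\underline p\,I\le P_k^{x,u}\le\bar p\,I\qquad\text{for all }k\ge0 .$$ Moreover, if in addition $Q_k\ge \underline q I$ and $R_k\ge\underline r I$ for all $k$ with some $\underline q,\underline r>0$ and $P_0^{x,u}>0$, then $\underline p$ can be chosen positive. -/

import Mathlib

open scoped Matrix Matrix.Norms.L2Operator

noncomputable section

/-! ### Moore-Penrose inverse of a real matrix -/

/-- `X` satisfies the four Penrose equations for `A`. -/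
structure IsMoorePenrose {p q : Type*} [Fintype p] [Fintype q]
    (A : Matrix p q ℝ) (X : Matrix q p ℝ) : Prop where
  mul_mul_self : A * X * A = A
  mul_mul_inv : X * A * X = X
  symm_left : (A * X)ᵀ = A * X
  symm_right : (X * A)ᵀ = X * A

theorem IsMoorePenrose.exists {p q : Type*} [Fintype p] [Fintype q] [DecidableEq q]
    (A : Matrix p q ℝ) : ∃ X : Matrix q p ℝ, IsMoorePenrose A X := by
  have hS : (Aᵀ * A).IsHermitian := by
    rw [← Matrix.conjTranspose_eq_transpose_of_trivial]
    exact Matrix.isHermitian_conjTranspose_mul_self A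
  obtain ⟨T, hT, h1, h2, h3⟩ : ∃ T : Matrix q q ℝ, Tᵀ = T ∧ (Aᵀ * A) * T * (Aᵀ * A) = Aᵀ * A ∧
      T * (Aᵀ * A) * T = T ∧ (T * (Aᵀ * A))ᵀ = T * (Aᵀ * A) := by
    obtain ⟨U, e, hUU, hspec⟩ : ∃ (U : Matrix q q ℝ) (e : q → ℝ), Uᵀ * U = 1 ∧
        Aᵀ * A = U * Matrix.diagonal e * Uᵀ := by
      refine ⟨(hS.eigenvectorUnitary : Matrix q q ℝ), hS.eigenvalues, ?_, ?_⟩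
      · have := Unitary.coe_star_mul_self hS.eigenvectorUnitary
        rwa [Matrix.star_eq_conjTranspose, Matrix.conjTranspose_eq_transpose_of_trivial] at this
      · have := hS.spectral_theorem
        rw [Unitary.conjStarAlgAut_apply, Matrix.star_eq_conjTranspose,
          Matrix.conjTranspose_eq_transpose_of_trivial] at this
        exact this
    have key : ∀ D E : Matrix q q ℝ, U * D * Uᵀ * (U * E * Uᵀ) = U * (D * E) * Uᵀ := by
      intro D E
      calc U * D * Uᵀ * (U * E * Uᵀ) = U * D * (Uᵀ * U) * E * Uᵀ := by noncomm_ring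
        _ = _ := by rw [hUU]; noncomm_ring
    refine ⟨U * Matrix.diagonal (fun i => (e i)⁻¹) * Uᵀ, ?_, ?_, ?_, ?_⟩
    · simp [Matrix.transpose_mul, Matrix.mul_assoc]
    · rw [hspec, key, key, Matrix.diagonal_mul_diagonal, Matrix.diagonal_mul_diagonal]
      congr 3
      funext i
      by_cases h : e i = 0 <;> simp [h]
    · rw [hspec, key, key, Matrix.diagonal_mul_diagonal, Matrix.diagonal_mul_diagonal]
      congr 3
      funext i
      by_cases h : e i = 0 <;> simp [h]
    · rw [hspec, key, Matrix.diagonal_mul_diagonal]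
      simp [Matrix.transpose_mul, Matrix.mul_assoc]
  refine ⟨T * Aᵀ, ?_, ?_, ?_, ?_⟩
  · have hz : (A * (T * Aᵀ) * A - A)ᴴ * (A * (T * Aᵀ) * A - A) = 0 := by
      rw [Matrix.conjTranspose_eq_transpose_of_trivial]
      have e : A * (T * Aᵀ) * A - A = A * (T * (Aᵀ * A) - 1) := by
        simp only [Matrix.mul_sub, Matrix.mul_assoc, Matrix.mul_one]
      have e2 : (Aᵀ * A) * (T * (Aᵀ * A) - 1) = 0 := by
        rw [Matrix.mul_sub, ← Matrix.mul_assoc, h1, Matrix.mul_one, sub_self]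
      rw [e, Matrix.transpose_mul, Matrix.mul_assoc, ← Matrix.mul_assoc Aᵀ, e2, Matrix.mul_zero]
    exact sub_eq_zero.mp (Matrix.conjTranspose_mul_self_eq_zero.mp hz)
  · calc T * Aᵀ * A * (T * Aᵀ) = (T * (Aᵀ * A) * T) * Aᵀ := by simp only [Matrix.mul_assoc]
      _ = T * Aᵀ := by rw [h2]
  · simp [Matrix.transpose_mul, hT, Matrix.mul_assoc]
  · rw [Matrix.mul_assoc]; exact h3

theorem IsMoorePenrose.unique {p q : Type*} [Fintype p] [Fintype q]
    {A : Matrix p q ℝ} {X Y : Matrix q p ℝ} (hX : IsMoorePenrose A X) (hY : IsMoorePenrose A Y) :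
    X = Y := by
  have e1 : A * X = A * Y := by
    calc A * X = (A * X)ᵀ := hX.symm_left.symm
      _ = ((A * Y) * (A * X))ᵀ := by rw [← Matrix.mul_assoc, hY.mul_mul_self]
      _ = (A * X) * (A * Y) := by rw [Matrix.transpose_mul, hX.symm_left, hY.symm_left]
      _ = A * Y := by rw [← Matrix.mul_assoc, hX.mul_mul_self]
  have e2 : X * A = Y * A := by
    calc X * A = (X * A)ᵀ := hX.symm_right.symm
      _ = ((X * A) * (Y * A))ᵀ := by
          rw [Matrix.mul_assoc, ← Matrix.mul_assoc A, hY.mul_mul_self]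
      _ = (Y * A) * (X * A) := by rw [Matrix.transpose_mul, hX.symm_right, hY.symm_right]
      _ = Y * A := by rw [Matrix.mul_assoc, ← Matrix.mul_assoc A, hX.mul_mul_self]
  calc X = X * A * X := hX.mul_mul_inv.symm
    _ = Y * (A * Y) := by rw [e2, Matrix.mul_assoc, e1]
    _ = Y := by rw [← Matrix.mul_assoc, hY.mul_mul_inv]

/-- The Moore-Penrose inverse of a real matrix. -/
def pinv {p q : Type*} [Fintype p] [Fintype q] [DecidableEq q] (A : Matrix p q ℝ) :
    Matrix q p ℝ :=
  Classical.choose (IsMoorePenrose.exists A)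

theorem pinv_spec {p q : Type*} [Fintype p] [Fintype q] [DecidableEq q] (A : Matrix p q ℝ) :
    IsMoorePenrose A (pinv A) :=
  Classical.choose_spec (IsMoorePenrose.exists A)

/-- On invertible matrices the Moore-Penrose inverse is the inverse. -/
theorem pinv_eq_inv {p : Type*} [Fintype p] [DecidableEq p] {A : Matrix p p ℝ}
    (hA : IsUnit A) : pinv A = A⁻¹ := by
  have hd : IsUnit A.det := (Matrix.isUnit_iff_isUnit_det A).mp hA
  refine (pinv_spec A).unique ⟨?_, ?_, ?_, ?_⟩ <;>
    simp [Matrix.mul_nonsing_inv _ hd, Matrix.nonsing_inv_mul _ hd]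

/-! ### Uniform detectability -/

/-- `transition F k j` is the transition matrix `Φ(k+j, k) = F (k+j-1) ⋯ F (k+1) F k` of the
linear time-varying system `x (i+1) = F i x i`. -/
def transition {n : ℕ} (F : ℕ → Matrix (Fin n) (Fin n) ℝ) (k : ℕ) :
    ℕ → Matrix (Fin n) (Fin n) ℝ
  | 0 => 1
  | j + 1 => F (k + j) * transition F k j

/-- The observability Gramian `∑_{i=k}^{k+s} Φ(i,k)ᵀ (H i)ᵀ (H i) Φ(i,k)`. -/
def obsGramian {n p : ℕ} (H : ℕ → Matrix (Fin p) (Fin n) ℝ) (F : ℕ → Matrix (Fin n) (Fin n) ℝ)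
    (k s : ℕ) : Matrix (Fin n) (Fin n) ℝ :=
  ∑ i ∈ Finset.range (s + 1), (transition F k i)ᵀ * (H (k + i))ᵀ * H (k + i) * transition F k i

/-- Uniform detectability (Anderson and Moore) of the bounded time-varying system
`x (k+1) = F k x k`, `y k = H k x k`: directions that do not contract by the factor `d` over
`t` steps are uniformly observable over `s` steps. -/
def UniformlyDetectable {n p : ℕ} (H : ℕ → Matrix (Fin p) (Fin n) ℝ)
    (F : ℕ → Matrix (Fin n) (Fin n) ℝ) : Prop :=
  (∃ h : ℝ, ∀ k, ‖H k‖ ≤ h) ∧ (∃ f : ℝ, ∀ k, ‖F k‖ ≤ f) ∧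
  ∃ (s t : ℕ) (d b : ℝ), 0 ≤ d ∧ d < 1 ∧ 0 < b ∧
    ∀ (k : ℕ) (ξ : Fin n → ℝ),
      d * ‖WithLp.toLp 2 ξ‖ ≤ ‖WithLp.toLp 2 (transition F k t *ᵥ ξ)‖ →
        b * (ξ ⬝ᵥ ξ) ≤ ξ ⬝ᵥ (obsGramian H F k s *ᵥ ξ)

/-! ### The covariance recursion of the constrained attack-resilient estimator -/

/-- Data of the covariance recursion of the constrained attack-resilient estimator for
`x (k+1) = A k x k + B k u k + G k d k + w k`, `y k = C k x k + v k`, with noise covariances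
`Q k` of `w k` and `R k` of `v k`, and state constraints `𝓑 k x k ≤ c k`.
`active k` is the set of indices of the rows of `𝓑 k` used in the projection at time `k` (the
active constraints), and `P₀` is the initial unconstrained state error covariance. -/
structure CAREData (n ny nd : ℕ) (nc : ℕ → ℕ) where
  A : ℕ → Matrix (Fin n) (Fin n) ℝ
  C : ℕ → Matrix (Fin ny) (Fin n) ℝ
  G : ℕ → Matrix (Fin n) (Fin nd) ℝ
  Q : ℕ → Matrix (Fin n) (Fin n) ℝ
  R : ℕ → Matrix (Fin ny) (Fin ny) ℝ
  𝓑 : (k : ℕ) → Matrix (Fin (nc k)) (Fin n) ℝ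
  active : (k : ℕ) → Finset (Fin (nc k))
  P₀ : Matrix (Fin n) (Fin n) ℝ

namespace CAREData

variable {n ny nd : ℕ} {nc : ℕ → ℕ} (D : CAREData n ny nd nc)

/-! One step of the algorithm, from time `k` to time `k + 1`. The argument `Px` stands for the
covariance `Pˣ_k` of the projected estimate. -/

/-- The predicted covariance `P^{x,-}_{k+1}`. -/
def predCov (k : ℕ) (Px : Matrix (Fin n) (Fin n) ℝ) : Matrix (Fin n) (Fin n) ℝ :=
  D.A k * Px * (D.A k)ᵀ + D.Q k

/-- `R̃_{k+1}`. -/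
def Rtilde (k : ℕ) (Px : Matrix (Fin n) (Fin n) ℝ) : Matrix (Fin ny) (Fin ny) ℝ :=
  (D.C (k + 1) * D.predCov k Px * (D.C (k + 1))ᵀ + D.R (k + 1))⁻¹

/-- `G_kᵀ C_{k+1}ᵀ R̃_{k+1} C_{k+1} G_k`, the inverse of `P^{d,u}_k`. -/
def attackInfo (k : ℕ) (Px : Matrix (Fin n) (Fin n) ℝ) : Matrix (Fin nd) (Fin nd) ℝ :=
  (D.G k)ᵀ * (D.C (k + 1))ᵀ * D.Rtilde k Px * D.C (k + 1) * D.G k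

/-- The attack estimation gain `M_{k+1}`. -/
def attackGain (k : ℕ) (Px : Matrix (Fin n) (Fin n) ℝ) : Matrix (Fin nd) (Fin ny) ℝ :=
  (D.attackInfo k Px)⁻¹ * (D.G k)ᵀ * (D.C (k + 1))ᵀ * D.Rtilde k Px

/-- The attack error covariance `P^{d,u}_k`. -/
def Pdu (k : ℕ) (Px : Matrix (Fin n) (Fin n) ℝ) : Matrix (Fin nd) (Fin nd) ℝ :=
  (D.attackInfo k Px)⁻¹

/-- The cross covariance `P^{xd}_k`. -/
def Pxd (k : ℕ) (Px : Matrix (Fin n) (Fin n) ℝ) : Matrix (Fin n) (Fin nd) ℝ :=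
  -(Px * (D.A k)ᵀ * (D.C (k + 1))ᵀ * (D.attackGain k Px)ᵀ)

/-- The covariance `P^{x⋆}_{k+1}` after the time update. -/
def Pstar (k : ℕ) (Px : Matrix (Fin n) (Fin n) ℝ) : Matrix (Fin n) (Fin n) ℝ :=
  D.A k * Px * (D.A k)ᵀ + D.A k * D.Pxd k Px * (D.G k)ᵀ + D.G k * (D.Pxd k Px)ᵀ * (D.A k)ᵀ
    + D.G k * D.Pdu k Px * (D.G k)ᵀ
    - D.G k * D.attackGain k Px * D.C (k + 1) * D.Q k
    - D.Q k * (D.C (k + 1))ᵀ * (D.attackGain k Px)ᵀ * (D.G k)ᵀ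
    + D.Q k

/-- `R̃⋆_{k+1}`. -/
def RtildeStar (k : ℕ) (Px : Matrix (Fin n) (Fin n) ℝ) : Matrix (Fin ny) (Fin ny) ℝ :=
  D.C (k + 1) * D.Pstar k Px * (D.C (k + 1))ᵀ
    - D.C (k + 1) * D.G k * D.attackGain k Px * D.R (k + 1)
    - D.R (k + 1) * (D.attackGain k Px)ᵀ * (D.G k)ᵀ * (D.C (k + 1))ᵀ
    + D.R (k + 1)

/-- The measurement update gain `L_{k+1}`. -/
def stateGain (k : ℕ) (Px : Matrix (Fin n) (Fin n) ℝ) : Matrix (Fin n) (Fin ny) ℝ :=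
  (D.Pstar k Px * (D.C (k + 1))ᵀ - D.G k * D.attackGain k Px * D.R (k + 1))
    * pinv (D.RtildeStar k Px)

/-- The covariance `P^{x,u}_{k+1}` after the measurement update. -/
def measUpdate (k : ℕ) (Px : Matrix (Fin n) (Fin n) ℝ) : Matrix (Fin n) (Fin n) ℝ :=
  (1 - D.stateGain k Px * D.C (k + 1)) * D.G k * D.attackGain k Px * D.R (k + 1)
      * (D.stateGain k Px)ᵀ
    + D.stateGain k Px * D.R (k + 1) * (D.attackGain k Px)ᵀ * (D.G k)ᵀ
      * (1 - D.stateGain k Px * D.C (k + 1))ᵀ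
    + (1 - D.stateGain k Px * D.C (k + 1)) * D.Pstar k Px
      * (1 - D.stateGain k Px * D.C (k + 1))ᵀ
    + D.stateGain k Px * D.R (k + 1) * (D.stateGain k Px)ᵀ

/-- `𝓑̄_k`: the selected rows of `𝓑_k`. -/
def Bbar (k : ℕ) : Matrix (D.active k) (Fin n) ℝ :=
  (D.𝓑 k).submatrix Subtype.val id

/-- The projection factor `Γ̄_k = I - γ_k 𝓑̄_k`, with `γ_k = P 𝓑̄_kᵀ (𝓑̄_k P 𝓑̄_kᵀ)⁻¹`, where
`P` stands for `P^{x,u}_k`. -/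
def projFactor (k : ℕ) (P : Matrix (Fin n) (Fin n) ℝ) : Matrix (Fin n) (Fin n) ℝ :=
  1 - P * (D.Bbar k)ᵀ * (D.Bbar k * P * (D.Bbar k)ᵀ)⁻¹ * D.Bbar k

/-- The unconstrained state error covariance `P^{x,u}_k`, started at `P₀` and updated by the
projection at time `k` followed by the step from `k` to `k + 1`. -/
def Pxu : ℕ → Matrix (Fin n) (Fin n) ℝ
  | 0 => D.P₀
  | k + 1 => D.measUpdate k (D.projFactor k (Pxu k) * Pxu k * (D.projFactor k (Pxu k))ᵀ)

/-- `Γ̄_k` along the recursion. -/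
def GammaBar (k : ℕ) : Matrix (Fin n) (Fin n) ℝ :=
  D.projFactor k (D.Pxu k)

/-- The covariance `Pˣ_k = Γ̄_k P^{x,u}_k Γ̄_kᵀ` of the projected estimate. -/
def Px (k : ℕ) : Matrix (Fin n) (Fin n) ℝ :=
  D.GammaBar k * D.Pxu k * (D.GammaBar k)ᵀ

/-- `D.M k` is the attack estimation gain `M_{k+1}` along the recursion. -/
def M (k : ℕ) : Matrix (Fin nd) (Fin ny) ℝ :=
  D.attackGain k (D.Px k)

/-- `Ā_k = (I - G_k M_{k+1} C_{k+1}) A_k`. -/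
def Abar (k : ℕ) : Matrix (Fin n) (Fin n) ℝ :=
  (1 - D.G k * D.M k * D.C (k + 1)) * D.A k

/-- `Ã_k = (I - G_k M_{k+1} (C_{k+1} G_k M_{k+1})^† C_{k+1}) Ā_k Γ̄_k`. The Moore-Penrose
inverse is the inverse when `C_{k+1} G_k M_{k+1}` is invertible, see `pinv_eq_inv`. -/
def Atilde (k : ℕ) : Matrix (Fin n) (Fin n) ℝ :=
  (1 - D.G k * D.M k * pinv (D.C (k + 1) * D.G k * D.M k) * D.C (k + 1))
    * D.Abar k * D.GammaBar k

end CAREData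

end

/-! The proof follows the quadratic forms `V_k(x) = xᵀ P_k^{x,u} x` along dual trajectories.

Upper bound. Write e for the prediction error and v for the measurement noise. The updated error is
linear in the uncorrelated pair (e, v), and the gain L solves the normal equations, so it is
optimal: replacing it by any other injection only increases `V_{k+1}(x)` (`quadForm_measUpdate_le`).
One particular injection makes the old form appear at `Ãᵀ(x - Cᵀu)`, with u still arbitrary. The
remaining cost is at most a constant times `|x|² + |u|²`, because `CGM` is idempotent and the
Moore–Penrose inverse of an idempotent is a contraction (`exists_step_bound`).

Detectability supplies good choices of u. Over a fixed horizon the state energy is halved up to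
output energy (`exists_horizon`). Regularized least squares dualizes this: bounded injections steer
the dual state to at most half its squared norm (`exists_output_injection`). Hence a bound B for the
forms at one time gives `B/2 + K` one horizon later, and this recursion stays bounded
(`exists_cost_bound`).

Lower bound. Zero always works, since the covariances are semidefinite. The two error factors
satisfy `U₁ + U₂C = 1`, so no direction x is annihilated by both transposes. With Q and R uniformly
definite, each update is therefore bounded below whatever the previous covariance was. -/

/-! ### Squared Euclidean norms and quadratic forms -/

/-- The squared Euclidean norm of a vector. -/
def sqNorm {m : Type*} [Fintype m] (x : m → ℝ) : ℝ := x ⬝ᵥ x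

/-- The quadratic form of a matrix. -/
def quadForm {m : Type*} [Fintype m] (P : Matrix m m ℝ) (x : m → ℝ) : ℝ := x ⬝ᵥ P *ᵥ x

section Vectors

variable {l m : Type*} [Fintype l] [Fintype m]

theorem sqNorm_nonneg (x : m → ℝ) : 0 ≤ sqNorm x :=
  Finset.sum_nonneg fun i _ => mul_self_nonneg (x i)

theorem sqNorm_zero : sqNorm (0 : m → ℝ) = 0 := by simp [sqNorm]

theorem sqNorm_smul (a : ℝ) (x : m → ℝ) : sqNorm (a • x) = a ^ 2 * sqNorm x := by
  simp only [sqNorm, smul_dotProduct, dotProduct_smul, smul_eq_mul]; ring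

theorem sqNorm_add (x y : m → ℝ) : sqNorm (x + y) = sqNorm x + 2 * (x ⬝ᵥ y) + sqNorm y := by
  simp only [sqNorm, add_dotProduct, dotProduct_add, dotProduct_comm y x]; ring

theorem sqNorm_sub (x y : m → ℝ) : sqNorm (x - y) = sqNorm x - 2 * (x ⬝ᵥ y) + sqNorm y := by
  simp only [sqNorm, sub_dotProduct, dotProduct_sub, dotProduct_comm y x]; ring

theorem sqNorm_add_le (x y : m → ℝ) : sqNorm (x + y) ≤ 2 * sqNorm x + 2 * sqNorm y := by
  have := sqNorm_nonneg (x - y)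
  rw [sqNorm_sub] at this
  rw [sqNorm_add]; linarith

theorem sqNorm_sub_le (x y : m → ℝ) : sqNorm (x - y) ≤ 2 * sqNorm x + 2 * sqNorm y := by
  have := sqNorm_nonneg (x + y)
  rw [sqNorm_add] at this
  rw [sqNorm_sub]; linarith

theorem norm_toLp_sq (x : m → ℝ) : ‖WithLp.toLp 2 x‖ ^ 2 = sqNorm x := by
  rw [EuclideanSpace.norm_sq_eq]
  simp [sqNorm, dotProduct, sq]

theorem dotProduct_sq_le (x y : m → ℝ) : (x ⬝ᵥ y) ^ 2 ≤ sqNorm x * sqNorm y := by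
  simpa [sqNorm, dotProduct, sq] using Finset.sum_mul_sq_le_sq_mul_sq Finset.univ x y

theorem dotProduct_mulVec_transpose (A : Matrix l m ℝ) (x : l → ℝ) (y : m → ℝ) :
    x ⬝ᵥ A *ᵥ y = (Aᵀ *ᵥ x) ⬝ᵥ y := by
  rw [Matrix.dotProduct_mulVec, Matrix.mulVec_transpose]

theorem quadForm_conj (B : Matrix l m ℝ) (P : Matrix m m ℝ) (x : l → ℝ) :
    quadForm (B * P * Bᵀ) x = quadForm P (Bᵀ *ᵥ x) := by
  simp only [quadForm, ← Matrix.mulVec_mulVec]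
  rw [dotProduct_mulVec_transpose B]

theorem quadForm_add (P Q : Matrix m m ℝ) (x : m → ℝ) :
    quadForm (P + Q) x = quadForm P x + quadForm Q x := by
  simp [quadForm, Matrix.add_mulVec, dotProduct_add]

theorem quadForm_sub (P Q : Matrix m m ℝ) (x : m → ℝ) :
    quadForm (P - Q) x = quadForm P x - quadForm Q x := by
  simp [quadForm, Matrix.sub_mulVec, dotProduct_sub]

theorem quadForm_smul_one [DecidableEq m] (a : ℝ) (x : m → ℝ) :
    quadForm (a • (1 : Matrix m m ℝ)) x = a * sqNorm x := by
  simp [quadForm, sqNorm, Matrix.smul_mulVec, dotProduct_smul]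

theorem posSemidef_iff_quadForm {P : Matrix m m ℝ} :
    P.PosSemidef ↔ Pᵀ = P ∧ ∀ x, 0 ≤ quadForm P x := by
  rw [Matrix.posSemidef_iff_dotProduct_mulVec, Matrix.IsHermitian,
    Matrix.conjTranspose_eq_transpose_of_trivial]
  simp [quadForm]

theorem Matrix.PosSemidef.conj_transpose {P : Matrix m m ℝ} (hP : P.PosSemidef)
    (B : Matrix l m ℝ) : (B * P * Bᵀ).PosSemidef := by
  simpa [Matrix.conjTranspose_eq_transpose_of_trivial] using hP.mul_mul_conjTranspose_same B

variable [DecidableEq m]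

theorem sqNorm_mulVec_le (A : Matrix l m ℝ) (x : m → ℝ) :
    sqNorm (A *ᵥ x) ≤ ‖A‖ ^ 2 * sqNorm x := by
  have h := Matrix.l2_opNorm_mulVec A (WithLp.toLp 2 x)
  rw [← norm_toLp_sq, ← norm_toLp_sq, ← mul_pow]
  exact pow_le_pow_left₀ (norm_nonneg _) h 2

theorem sqNorm_mulVec_le_of_norm_le {A : Matrix l m ℝ} {a : ℝ} (hA : ‖A‖ ≤ a) (x : m → ℝ) :
    sqNorm (A *ᵥ x) ≤ a ^ 2 * sqNorm x :=
  (sqNorm_mulVec_le A x).trans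
    (mul_le_mul_of_nonneg_right (pow_le_pow_left₀ (norm_nonneg _) hA 2) (sqNorm_nonneg x))

variable [DecidableEq l]

theorem norm_transpose (A : Matrix l m ℝ) : ‖Aᵀ‖ = ‖A‖ := by
  rw [← Matrix.conjTranspose_eq_transpose_of_trivial, Matrix.l2_opNorm_conjTranspose]

theorem sqNorm_transpose_mulVec_le {A : Matrix l m ℝ} {a : ℝ} (hA : ‖A‖ ≤ a) (x : l → ℝ) :
    sqNorm (Aᵀ *ᵥ x) ≤ a ^ 2 * sqNorm x :=
  sqNorm_mulVec_le_of_norm_le ((norm_transpose A).trans_le hA) x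

theorem quadForm_le {P : Matrix m m ℝ} {a : ℝ} (hP : ‖P‖ ≤ a) (x : m → ℝ) :
    quadForm P x ≤ a * sqNorm x := by
  have ha : 0 ≤ a := (norm_nonneg _).trans hP
  have h1 := dotProduct_sq_le x (P *ᵥ x)
  have h2 := sqNorm_mulVec_le_of_norm_le hP x
  refine abs_le_of_sq_le_sq' ?_ (mul_nonneg ha (sqNorm_nonneg x)) |>.2
  calc (quadForm P x) ^ 2 ≤ sqNorm x * sqNorm (P *ᵥ x) := h1
    _ ≤ sqNorm x * (a ^ 2 * sqNorm x) := mul_le_mul_of_nonneg_left h2 (sqNorm_nonneg x)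
    _ = (a * sqNorm x) ^ 2 := by ring

end Vectors

/-! ### Consequences of uniform detectability -/

section Detectability

variable {n p : ℕ} (H : ℕ → Matrix (Fin p) (Fin n) ℝ) (F : ℕ → Matrix (Fin n) (Fin n) ℝ)

theorem transition_add (k i j : ℕ) :
    transition F k (i + j) = transition F (k + i) j * transition F k i := by
  induction j with
  | zero => simp [transition]
  | succ j ih => rw [← add_assoc, transition, transition, ih, Matrix.mul_assoc, add_assoc]

theorem transition_one (k : ℕ) : transition F k 1 = F k := by simp [transition]

/-- The output energy of the trajectory started at time `k` in `x`, over `N` samples. -/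
def outputEnergy (k N : ℕ) (x : Fin n → ℝ) : ℝ :=
  ∑ i ∈ Finset.range N, sqNorm (H (k + i) *ᵥ transition F k i *ᵥ x)

theorem outputEnergy_nonneg (k N : ℕ) (x : Fin n → ℝ) : 0 ≤ outputEnergy H F k N x :=
  Finset.sum_nonneg fun _ _ => sqNorm_nonneg _

theorem outputEnergy_mono (k : ℕ) {N N' : ℕ} (h : N ≤ N') (x : Fin n → ℝ) :
    outputEnergy H F k N x ≤ outputEnergy H F k N' x :=
  Finset.sum_le_sum_of_subset_of_nonneg (Finset.range_mono h) fun _ _ _ => sqNorm_nonneg _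

theorem outputEnergy_shift_le (k j N : ℕ) (x : Fin n → ℝ) :
    outputEnergy H F (k + j) N (transition F k j *ᵥ x) ≤ outputEnergy H F k (j + N) x := by
  unfold outputEnergy
  rw [Finset.sum_range_add]
  refine le_add_of_nonneg_of_le (Finset.sum_nonneg fun _ _ => sqNorm_nonneg _) (le_of_eq ?_)
  refine Finset.sum_congr rfl fun i _ => ?_
  rw [transition_add, ← Matrix.mulVec_mulVec, add_assoc]

theorem quadForm_obsGramian (k s : ℕ) (x : Fin n → ℝ) :
    x ⬝ᵥ (obsGramian H F k s *ᵥ x) = outputEnergy H F k (s + 1) x := by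
  unfold obsGramian outputEnergy
  rw [Matrix.sum_mulVec, dotProduct_sum]
  refine Finset.sum_congr rfl fun i _ => ?_
  simp only [← Matrix.mulVec_mulVec]
  rw [dotProduct_mulVec_transpose, Matrix.transpose_transpose, dotProduct_mulVec_transpose,
    Matrix.transpose_transpose, sqNorm]

variable {F}

theorem sqNorm_transition_le {f : ℝ} (hF : ∀ k, ‖F k‖ ≤ f) (k j : ℕ) (x : Fin n → ℝ) :
    sqNorm (transition F k j *ᵥ x) ≤ (f ^ 2) ^ j * sqNorm x := by
  induction j with
  | zero => simp [transition]
  | succ j ih =>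
    rw [transition, ← Matrix.mulVec_mulVec]
    refine (sqNorm_mulVec_le_of_norm_le (hF _) _).trans ?_
    rw [pow_succ' (f ^ 2), mul_assoc]
    exact mul_le_mul_of_nonneg_left ih (sq_nonneg f)

variable {H}

/-- One window of a uniformly detectable system: up to the observed energy the state contracts. -/
theorem UniformlyDetectable.exists_window (h : UniformlyDetectable H F) :
    ∃ (s t : ℕ) (r c : ℝ), 0 ≤ r ∧ r < 1 ∧ 0 ≤ c ∧ ∀ k x,
      sqNorm (transition F k t *ᵥ x) ≤ r * sqNorm x + c * outputEnergy H F k s x := by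
  obtain ⟨-, ⟨f, hF⟩, s, t, d, b, hd0, hd1, hb, hdet⟩ := h
  refine ⟨s + 1, t, d ^ 2, (f ^ 2) ^ t / b, sq_nonneg d, by nlinarith, by positivity, ?_⟩
  intro k x
  have hE := outputEnergy_nonneg H F k (s + 1) x
  -- Non-contracting directions are observable, so `|Φx|² ≤ f^(2t)|x|²` is paid for by the output
  -- energy divided by b; all others contract by `d²`.
  by_cases hx : d * ‖WithLp.toLp 2 x‖ ≤ ‖WithLp.toLp 2 (transition F k t *ᵥ x)‖
  · have h1 := hdet k x hx
    rw [quadForm_obsGramian] at h1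
    refine (sqNorm_transition_le hF k t x).trans ?_
    refine le_add_of_nonneg_of_le (mul_nonneg (sq_nonneg d) (sqNorm_nonneg x)) ?_
    rw [div_mul_eq_mul_div, mul_div_assoc]
    refine mul_le_mul_of_nonneg_left ?_ (by positivity)
    rw [le_div_iff₀ hb, mul_comm]
    exact h1
  · have h1 := pow_le_pow_left₀ (norm_nonneg _) (not_le.mp hx).le 2
    rw [mul_pow, norm_toLp_sq, norm_toLp_sq] at h1
    exact h1.trans (le_add_of_nonneg_right (by positivity))

/-- Windows can be concatenated. -/
theorem exists_iterated_window {s t : ℕ} {r c : ℝ} (hr : 0 ≤ r) (hc : 0 ≤ c)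
    (h : ∀ k x, sqNorm (transition F k t *ᵥ x) ≤ r * sqNorm x + c * outputEnergy H F k s x)
    (m : ℕ) : ∃ c', 0 ≤ c' ∧ ∀ k x, sqNorm (transition F k (m * t) *ᵥ x) ≤
      r ^ m * sqNorm x + c' * outputEnergy H F k (m * t + s) x := by
  induction m with
  | zero =>
    refine ⟨0, le_rfl, fun k x => ?_⟩
    simp [transition]
  | succ m ih =>
    obtain ⟨c', hc', ih⟩ := ih
    refine ⟨r * c' + c, by positivity, fun k x => ?_⟩
    have h1 := h (k + m * t) (transition F k (m * t) *ᵥ x)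
    have h2 := mul_le_mul_of_nonneg_left (ih k x) hr
    have h3 := mul_le_mul_of_nonneg_left (outputEnergy_shift_le H F k (m * t) s x) hc
    have h4 : outputEnergy H F k (m * t + s) x ≤ outputEnergy H F k (m * t + t + s) x :=
      outputEnergy_mono H F k (by omega) x
    have h5 := mul_le_mul_of_nonneg_left h4 (add_nonneg (mul_nonneg hr hc') hc)
    rw [Nat.succ_mul, transition_add, ← Matrix.mulVec_mulVec, pow_succ']
    linarith

/-- In a uniformly detectable system there is a horizon over which the state contracts by a fixed
factor, up to the energy of the outputs seen within that horizon, the initial one excluded. -/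
theorem UniformlyDetectable.exists_horizon (h : UniformlyDetectable H F) :
    ∃ (N : ℕ) (c : ℝ), 0 < N ∧ 0 < c ∧ ∀ k x,
      sqNorm (transition F k N *ᵥ x) ≤ (1 / 2) * sqNorm x + c * ∑ i ∈ Finset.range N,
        sqNorm (H (k + i + 1) *ᵥ transition F k (i + 1) *ᵥ x) := by
  obtain ⟨s, t, r, c, hr0, hr1, hc, hw⟩ := h.exists_window
  obtain ⟨-, ⟨f, hF⟩, -⟩ := h
  -- The first step costs `f²` and the last s steps cost `f^(2s)`; enough windows absorb both.
  obtain ⟨m, hm⟩ : ∃ m : ℕ, (f ^ 2) ^ s * (r ^ m * f ^ 2) ≤ 1 / 2 := by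
    have h0 : Filter.Tendsto (fun m : ℕ => (f ^ 2) ^ s * (r ^ m * f ^ 2)) Filter.atTop
        (nhds ((f ^ 2) ^ s * (0 * f ^ 2))) :=
      ((tendsto_pow_atTop_nhds_zero_of_lt_one hr0 hr1).mul_const _).const_mul _
    rw [zero_mul, mul_zero] at h0
    exact (h0.eventually_le_const (by norm_num : (0 : ℝ) < 1 / 2)).exists
  obtain ⟨c', hc', hmw⟩ := exists_iterated_window hr0 hc hw m
  -- One step discards the output at time k, then come m windows, then s more steps so that every
  -- output seen by the last window lies inside the horizon. The `+ 1` in the constant only makes it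
  -- positive.
  refine ⟨m * t + s + 1, (f ^ 2) ^ s * c' + 1, by omega, by positivity, fun k x => ?_⟩
  have e1 : m * t + s + 1 = 1 + (m * t + s) := by omega
  have e2 : transition F k (m * t + s + 1) *ᵥ x =
      transition F (k + 1 + m * t) s *ᵥ transition F (k + 1) (m * t) *ᵥ F k *ᵥ x := by
    rw [e1, transition_add, transition_add, transition_one]
    simp only [Matrix.mulVec_mulVec, Matrix.mul_assoc]
  have h1 : outputEnergy H F (k + 1) (m * t + s) (F k *ᵥ x) ≤
      ∑ i ∈ Finset.range (m * t + s + 1),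
        sqNorm (H (k + i + 1) *ᵥ transition F k (i + 1) *ᵥ x) := by
    refine (outputEnergy_mono H F (k + 1) (Nat.le_succ _) _).trans (le_of_eq ?_)
    refine Finset.sum_congr rfl fun i _ => ?_
    rw [add_comm i 1, transition_add, transition_one, ← Matrix.mulVec_mulVec]
    congr 3
    omega
  have h2 := sqNorm_transition_le hF (k + 1 + m * t) s
    (transition F (k + 1) (m * t) *ᵥ F k *ᵥ x)
  have h3 := mul_le_mul_of_nonneg_left (hmw (k + 1) (F k *ᵥ x))
    (by positivity : 0 ≤ (f ^ 2) ^ s)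
  have h4 := mul_le_mul_of_nonneg_left (sqNorm_mulVec_le_of_norm_le (hF k) x)
    (by positivity : 0 ≤ (f ^ 2) ^ s * r ^ m)
  have h5 := mul_le_mul_of_nonneg_left h1 (by positivity : 0 ≤ (f ^ 2) ^ s * c')
  have h6 := mul_le_mul_of_nonneg_right hm (sqNorm_nonneg x)
  have h7 := outputEnergy_nonneg H F (k + 1) (m * t + s) (F k *ᵥ x)
  rw [e2]
  linarith

end Detectability

/-! ### Uniform bounds for quadratic costs of detectable systems -/

section DualBound

variable {n p : ℕ}

/-- If `Φ` contracts up to the energy of the outputs `O i`, then every `Φᵀ η` can be corrected by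
bounded output injections to a vector of smaller norm. -/
theorem exists_output_injection {Φ : Matrix (Fin n) (Fin n) ℝ} {O : ℕ → Matrix (Fin p) (Fin n) ℝ}
    {N : ℕ} {c : ℝ} (hc : 0 < c)
    (h : ∀ x, sqNorm (Φ *ᵥ x) ≤ (1 / 2) * sqNorm x +
      c * ∑ i ∈ Finset.range N, sqNorm (O i *ᵥ x)) (η : Fin n → ℝ) :
    ∃ u : ℕ → Fin p → ℝ,
      sqNorm (Φᵀ *ᵥ η - ∑ i ∈ Finset.range N, (O i)ᵀ *ᵥ u i) ≤ (1 / 2) * sqNorm η ∧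
      ∑ i ∈ Finset.range N, sqNorm (u i) ≤ c * sqNorm η := by
  -- With `(W + ε)a = Φᵀη` and `u i = O i a`, the residual is `εa`. This ε turns the hypothesis at a
  -- into `|Φa|² ≤ c·E`, where `E = o + ε|a|²` is also `⟨Φa, η⟩`. Cauchy–Schwarz then gives `E ≤
  -- c|η|²`.
  set ε : ℝ := 1 / (2 * c) with hε
  have hε0 : 0 < ε := by positivity
  have hεc : ε * c = 1 / 2 := by rw [hε]; field_simp
  set W : Matrix (Fin n) (Fin n) ℝ := ∑ i ∈ Finset.range N, (O i)ᵀ * O i with hW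
  have hWpsd : W.PosSemidef := Matrix.posSemidef_sum _ fun i _ => by
    simpa [Matrix.conjTranspose_eq_transpose_of_trivial] using
      Matrix.posSemidef_conjTranspose_mul_self (O i)
  have hpd : (W + ε • (1 : Matrix (Fin n) (Fin n) ℝ)).PosDef :=
    Matrix.PosDef.posSemidef_add hWpsd (Matrix.PosDef.one.smul hε0)
  obtain ⟨a, ha⟩ : ∃ a, (W + ε • (1 : Matrix (Fin n) (Fin n) ℝ)) *ᵥ a = Φᵀ *ᵥ η := by
    refine ⟨(W + ε • (1 : Matrix (Fin n) (Fin n) ℝ))⁻¹ *ᵥ Φᵀ *ᵥ η, ?_⟩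
    rw [Matrix.mulVec_mulVec, Matrix.mul_nonsing_inv _
      ((Matrix.isUnit_iff_isUnit_det _).mp hpd.isUnit), Matrix.one_mulVec]
  have hWa : W *ᵥ a = ∑ i ∈ Finset.range N, (O i)ᵀ *ᵥ O i *ᵥ a := by
    rw [hW, Matrix.sum_mulVec]
    exact Finset.sum_congr rfl fun i _ => (Matrix.mulVec_mulVec _ _ _).symm
  rw [Matrix.add_mulVec, Matrix.smul_mulVec, Matrix.one_mulVec] at ha
  set o : ℝ := ∑ i ∈ Finset.range N, sqNorm (O i *ᵥ a) with ho
  have ho0 : 0 ≤ o := Finset.sum_nonneg fun _ _ => sqNorm_nonneg _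
  have hE : o + ε * sqNorm a = (Φ *ᵥ a) ⬝ᵥ η := by
    have e : a ⬝ᵥ W *ᵥ a = o := by
      rw [hWa, dotProduct_sum]
      exact Finset.sum_congr rfl fun i _ => by
        rw [dotProduct_mulVec_transpose, Matrix.transpose_transpose, sqNorm]
    rw [← e, sqNorm, ← smul_eq_mul, ← dotProduct_smul, ← dotProduct_add, ha,
      dotProduct_mulVec_transpose, Matrix.transpose_transpose]
  have hE0 : 0 ≤ o + ε * sqNorm a := add_nonneg ho0 (mul_nonneg hε0.le (sqNorm_nonneg a))
  have hle : o + ε * sqNorm a ≤ c * sqNorm η := by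
    have h1 := dotProduct_sq_le (Φ *ᵥ a) η
    rw [← hE] at h1
    have h2 := h1.trans (mul_le_mul_of_nonneg_right (h a) (sqNorm_nonneg η))
    have h3 : (1 / 2) * sqNorm a + c * o = c * (o + ε * sqNorm a) := by rw [← hεc]; ring
    rw [h3] at h2
    rcases hE0.eq_or_lt with h0 | h0
    · rw [← h0]; exact mul_nonneg hc.le (sqNorm_nonneg η)
    · refine le_of_mul_le_mul_left ?_ h0
      linarith
  refine ⟨fun i => O i *ᵥ a, ?_, ?_⟩
  · rw [← hWa, ← ha, add_sub_cancel_left, sqNorm_smul]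
    have h1 := mul_le_mul_of_nonneg_left hle hε0.le
    have h2 := mul_nonneg hε0.le ho0
    rw [← mul_assoc, hεc] at h1
    linarith
  · exact le_trans (le_add_of_nonneg_right (mul_nonneg hε0.le (sqNorm_nonneg a))) hle

variable {H : ℕ → Matrix (Fin p) (Fin n) ℝ} {F : ℕ → Matrix (Fin n) (Fin n) ℝ}
  {V : ℕ → (Fin n → ℝ) → ℝ}

/-- Iteration of a one-step cost bound along an arbitrary sequence of output injections. -/
theorem exists_block_bound {f h c : ℝ} (hF : ∀ k, ‖F k‖ ≤ f) (hH : ∀ k, ‖H k‖ ≤ h) (hc : 0 ≤ c)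
    (hstep : ∀ k x u, V (k + 1) x ≤
      V k ((F k)ᵀ *ᵥ (x - (H (k + 1))ᵀ *ᵥ u)) + c * (sqNorm x + sqNorm u)) (N : ℕ) :
    ∃ c', 0 ≤ c' ∧ ∀ (k : ℕ) (x : Fin n → ℝ) (u : ℕ → Fin p → ℝ), V (k + N) x ≤
      V k ((transition F k N)ᵀ *ᵥ x -
        ∑ i ∈ Finset.range N, (H (k + i + 1) * transition F k (i + 1))ᵀ *ᵥ u i) +
      c' * (sqNorm x + ∑ i ∈ Finset.range N, sqNorm (u i)) := by
  induction N with
  | zero =>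
    refine ⟨0, le_rfl, fun k x u => ?_⟩
    simp [transition]
  | succ N ih =>
    obtain ⟨c', hc', ih⟩ := ih
    refine ⟨c' * (2 * f ^ 2 + 2 * f ^ 2 * h ^ 2 + 1) + c, by positivity, fun k x u => ?_⟩
    -- The last injection is applied first: the dual trajectory runs backwards in time.
    set z := (F (k + N))ᵀ *ᵥ (x - (H (k + N + 1))ᵀ *ᵥ u N) with hz
    have e : (transition F k N)ᵀ *ᵥ z -
          ∑ i ∈ Finset.range N, (H (k + i + 1) * transition F k (i + 1))ᵀ *ᵥ u i =
        (transition F k (N + 1))ᵀ *ᵥ x -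
          ∑ i ∈ Finset.range (N + 1), (H (k + i + 1) * transition F k (i + 1))ᵀ *ᵥ u i := by
      rw [Finset.sum_range_succ, hz, transition]
      simp only [Matrix.transpose_mul, Matrix.mulVec_sub, Matrix.mulVec_mulVec, Matrix.mul_assoc]
      abel
    have h1 := hstep (k + N) x (u N)
    have h2 := ih k z u
    rw [e] at h2
    have hz1 : sqNorm z ≤ f ^ 2 * (2 * sqNorm x + 2 * (h ^ 2 * sqNorm (u N))) := by
      refine (sqNorm_transpose_mulVec_le (hF _) _).trans
        (mul_le_mul_of_nonneg_left ?_ (sq_nonneg f))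
      refine (sqNorm_sub_le _ _).trans ?_
      have := sqNorm_transpose_mulVec_le (hH (k + N + 1)) (u N)
      linarith
    have hS : 0 ≤ ∑ i ∈ Finset.range N, sqNorm (u i) :=
      Finset.sum_nonneg fun _ _ => sqNorm_nonneg _
    have hx := sqNorm_nonneg x
    have hu := sqNorm_nonneg (u N)
    have h3 : sqNorm z + ∑ i ∈ Finset.range N, sqNorm (u i) ≤
        (2 * f ^ 2 + 2 * f ^ 2 * h ^ 2 + 1) *
          (sqNorm x + ∑ i ∈ Finset.range (N + 1), sqNorm (u i)) := by
      rw [Finset.sum_range_succ]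
      have p1 : 0 ≤ (2 * f ^ 2) * (∑ i ∈ Finset.range N, sqNorm (u i) + sqNorm (u N)) := by
        positivity
      have p2 : 0 ≤ (2 * f ^ 2 * h ^ 2) * (∑ i ∈ Finset.range N, sqNorm (u i) + sqNorm x) := by
        positivity
      linarith
    have h4 := mul_le_mul_of_nonneg_left h3 hc'
    have h5 : c * (sqNorm x + sqNorm (u N)) ≤
        c * (sqNorm x + ∑ i ∈ Finset.range (N + 1), sqNorm (u i)) := by
      refine mul_le_mul_of_nonneg_left ?_ hc
      rw [Finset.sum_range_succ]
      linarith
    rw [← add_assoc]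
    linarith

/-- Costs that grow by a bounded amount in each step along every output-injected dual trajectory
of a uniformly detectable system stay uniformly bounded. -/
theorem UniformlyDetectable.exists_cost_bound (hdet : UniformlyDetectable H F) {c p₀ : ℝ}
    (hc : 0 ≤ c)
    (hstep : ∀ k x u, V (k + 1) x ≤
      V k ((F k)ᵀ *ᵥ (x - (H (k + 1))ᵀ *ᵥ u)) + c * (sqNorm x + sqNorm u))
    (h₀ : ∀ x, V 0 x ≤ p₀ * sqNorm x) :
    ∃ b, 0 ≤ b ∧ ∀ k x, V k x ≤ b * sqNorm x := by
  obtain ⟨N, C, hN, hC, hhor⟩ := hdet.exists_horizon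
  obtain ⟨⟨h, hH⟩, ⟨f, hF⟩, -⟩ := hdet
  obtain ⟨c', hc', hblock⟩ := exists_block_bound hF hH hc hstep N
  have hnum : ∀ k, ∃ b, 0 ≤ b ∧ ∀ x, V k x ≤ b * sqNorm x := by
    intro k
    induction k with
    | zero =>
      exact ⟨|p₀|, abs_nonneg _, fun x => (h₀ x).trans
        (mul_le_mul_of_nonneg_right (le_abs_self p₀) (sqNorm_nonneg x))⟩
    | succ k ih =>
      obtain ⟨b, hb, ih⟩ := ih
      refine ⟨b * f ^ 2 + c, by positivity, fun x => ?_⟩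
      have h1 := hstep k x 0
      rw [Matrix.mulVec_zero, sub_zero, sqNorm_zero, add_zero] at h1
      have h2 := ih ((F k)ᵀ *ᵥ x)
      have h3 := mul_le_mul_of_nonneg_left (sqNorm_transpose_mulVec_le (hF k) x) hb
      linarith
  choose b hb0 hb using hnum
  set K : ℝ := c' * (1 + C) with hK
  have hK0 : 0 ≤ K := by positivity
  -- The sum covers the first N times; `2K` is the fixed point of `B ↦ B/2 + K`.
  set B : ℝ := ∑ i ∈ Finset.range N, b i + 2 * K with hB
  have hsum0 : 0 ≤ ∑ i ∈ Finset.range N, b i := Finset.sum_nonneg fun i _ => hb0 i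
  have hB0 : 0 ≤ B := by positivity
  refine ⟨B, hB0, fun k => ?_⟩
  induction k using Nat.strong_induction_on with
  | _ k ih =>
    intro x
    rcases lt_or_ge k N with hk | hk
    · refine (hb k x).trans (mul_le_mul_of_nonneg_right ?_ (sqNorm_nonneg x))
      have := Finset.single_le_sum (f := b) (fun i _ => hb0 i) (Finset.mem_range.mpr hk)
      linarith
    · obtain ⟨j, rfl⟩ := Nat.exists_eq_add_of_le' hk
      obtain ⟨u, hu1, hu2⟩ := exists_output_injection
        (O := fun i => H (j + i + 1) * transition F j (i + 1)) hC
        (fun x => by simpa only [Matrix.mulVec_mulVec] using hhor j x) x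
      have h1 := hblock j x u
      have h2 := (ih j (by omega) _).trans (mul_le_mul_of_nonneg_left hu1 hB0)
      have h3 := mul_le_mul_of_nonneg_left hu2 hc'
      have h4 := mul_nonneg hsum0 (sqNorm_nonneg x)
      have h5 : B * ((1 / 2) * sqNorm x) + K * sqNorm x ≤ B * sqNorm x := by
        rw [hB]; linarith
      rw [hK] at h5
      linarith

end DualBound

/-! ### Moore-Penrose inverses of idempotents, and least squares -/

section LinearAlgebra

variable {l m : Type*} [Fintype l] [Fintype m]

theorem sqNorm_mulVec_le_of_isProj {P : Matrix m m ℝ} (hs : Pᵀ = P) (hp : P * P = P)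
    (x : m → ℝ) : sqNorm (P *ᵥ x) ≤ sqNorm x := by
  have h1 : sqNorm (P *ᵥ x) = x ⬝ᵥ P *ᵥ x := by
    rw [sqNorm, dotProduct_mulVec_transpose, hs, Matrix.mulVec_mulVec, hp, dotProduct_comm]
  have h2 := sqNorm_nonneg (x - P *ᵥ x)
  rw [sqNorm_sub, ← h1] at h2
  linarith

/-- For an idempotent X, inserting `X = X * X` into `X† X X†` exhibits `X†` as the product of the
orthogonal projections `X†X` and `XX†`. -/
theorem sqNorm_pinv_transpose_mulVec_le [DecidableEq m] {X : Matrix m m ℝ} (hX : X * X = X)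
    (x : m → ℝ) : sqNorm ((pinv X)ᵀ *ᵥ x) ≤ sqNorm x := by
  have hp := pinv_spec X
  have e : (pinv X)ᵀ = (X * pinv X) * (pinv X * X) := by
    rw [← hp.symm_left, ← hp.symm_right, ← Matrix.transpose_mul]
    congr 1
    calc pinv X = pinv X * X * pinv X := hp.mul_mul_inv.symm
      _ = pinv X * (X * X) * pinv X := by rw [hX]
      _ = pinv X * X * (X * pinv X) := by simp only [Matrix.mul_assoc]
  rw [e, ← Matrix.mulVec_mulVec]
  refine (sqNorm_mulVec_le_of_isProj hp.symm_left ?_ _).trans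
    (sqNorm_mulVec_le_of_isProj hp.symm_right ?_ _)
  · rw [← Matrix.mul_assoc, hp.mul_mul_self]
  · rw [← Matrix.mul_assoc, hp.mul_mul_inv]

theorem sqNorm_one_sub_mul_pinv_transpose_mulVec_le [DecidableEq m] (X : Matrix m m ℝ)
    (x : m → ℝ) : sqNorm ((1 - X * pinv X)ᵀ *ᵥ x) ≤ sqNorm x := by
  have hp := pinv_spec X
  have hs : (1 - X * pinv X)ᵀ = 1 - X * pinv X := by
    rw [Matrix.transpose_sub, Matrix.transpose_one, hp.symm_left]
  rw [hs]
  refine sqNorm_mulVec_le_of_isProj hs ?_ x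
  have : X * pinv X * (X * pinv X) = X * pinv X := by rw [← Matrix.mul_assoc, hp.mul_mul_self]
  rw [Matrix.mul_sub, Matrix.sub_mul _ _ (X * pinv X), this]
  simp

/-- Each column of B has vanishing S-form. -/
theorem eq_zero_of_transpose_mul_posDef_mul {S : Matrix m m ℝ} (hS : S.PosDef)
    {B : Matrix m l ℝ} (h : Bᵀ * S * B = 0) : B = 0 := by
  classical
  refine Matrix.ext_of_mulVec_single fun j => ?_
  by_contra hne
  rw [Matrix.zero_mulVec] at hne
  have h1 := hS.dotProduct_mulVec_pos hne
  have h2 : quadForm (Bᵀ * S * (Bᵀ)ᵀ) (Pi.single j (1 : ℝ)) = 0 := by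
    rw [Matrix.transpose_transpose, h]; simp [quadForm]
  rw [quadForm_conj, Matrix.transpose_transpose] at h2
  rw [star_trivial] at h1
  exact h1.ne' h2

/-- The normal equations `L (V S Vᵀ) = Y Vᵀ` are solved with the Moore-Penrose inverse. -/
theorem mul_pinv_mul_conj {r : Type*} [DecidableEq m] {S : Matrix m m ℝ} (hS : S.PosDef)
    (V : Matrix m m ℝ) (Y : Matrix r m ℝ) : Y * Vᵀ * pinv (V * S * Vᵀ) * (V * S * Vᵀ) = Y * Vᵀ := by
  set K := V * S * Vᵀ with hK
  have hp := pinv_spec K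
  -- E projects onto the kernel of K. Definiteness of S makes that kernel the kernel of `Vᵀ`, which
  -- is killed by `Y Vᵀ`.
  set E := 1 - pinv K * K with hE
  have h1 : K * E = 0 := by
    rw [hE, Matrix.mul_sub, Matrix.mul_one, ← Matrix.mul_assoc, hp.mul_mul_self, sub_self]
  have h2 : Vᵀ * E = 0 := by
    refine eq_zero_of_transpose_mul_posDef_mul hS ?_
    rw [Matrix.transpose_mul, Matrix.transpose_transpose]
    calc Eᵀ * V * S * (Vᵀ * E) = Eᵀ * (K * E) := by rw [hK]; simp only [Matrix.mul_assoc]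
      _ = 0 := by rw [h1, Matrix.mul_zero]
  have h3 : Y * Vᵀ * E = 0 := by rw [Matrix.mul_assoc, h2, Matrix.mul_zero]
  rw [hE, Matrix.mul_sub, Matrix.mul_one, ← Matrix.mul_assoc] at h3
  exact (sub_eq_zero.mp h3).symm

theorem quadForm_add_vec {P : Matrix m m ℝ} (hP : Pᵀ = P) (x y : m → ℝ) :
    quadForm P (x + y) = quadForm P x + 2 * (x ⬝ᵥ P *ᵥ y) + quadForm P y := by
  have : y ⬝ᵥ P *ᵥ x = x ⬝ᵥ P *ᵥ y := by
    rw [dotProduct_mulVec_transpose, hP, dotProduct_comm]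
  simp only [quadForm, Matrix.mulVec_add, add_dotProduct, dotProduct_add, this]
  ring

/-- A covariance whose error is uncorrelated with the innovations is minimal. -/
theorem quadForm_le_of_orthogonal {n : Type*} [Fintype n] {W : Matrix l l ℝ} {R : Matrix m m ℝ}
    (hW : W.PosSemidef) (hR : R.PosSemidef) {U₁ : Matrix n l ℝ} {U₂ : Matrix n m ℝ}
    {V₁ : Matrix m l ℝ} {V₂ : Matrix m m ℝ} (h : U₁ * W * V₁ᵀ = U₂ * R * V₂ᵀ)
    (x : n → ℝ) (v : m → ℝ) :
    quadForm (U₁ * W * U₁ᵀ + U₂ * R * U₂ᵀ) x ≤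
      quadForm W (U₁ᵀ *ᵥ x - V₁ᵀ *ᵥ v) + quadForm R (U₂ᵀ *ᵥ x + V₂ᵀ *ᵥ v) := by
  rw [posSemidef_iff_quadForm] at hW hR
  rw [quadForm_add, quadForm_conj, quadForm_conj, sub_eq_add_neg, quadForm_add_vec hW.1,
    quadForm_add_vec hR.1]
  -- By orthogonality the two cross terms cancel, leaving only nonnegative forms in v.
  have e : (U₁ᵀ *ᵥ x) ⬝ᵥ W *ᵥ V₁ᵀ *ᵥ v = (U₂ᵀ *ᵥ x) ⬝ᵥ R *ᵥ V₂ᵀ *ᵥ v := by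
    rw [← dotProduct_mulVec_transpose, ← dotProduct_mulVec_transpose]
    simp only [Matrix.mulVec_mulVec, ← Matrix.mul_assoc]
    rw [h]
  have h1 := hW.2 (-(V₁ᵀ *ᵥ v))
  have h2 := hR.2 (V₂ᵀ *ᵥ v)
  rw [Matrix.mulVec_neg, dotProduct_neg, e]
  linarith

end LinearAlgebra

namespace CAREData

/-! ### One step of the recursion -/

section OneStep

variable {n ny nd : ℕ} {nc : ℕ → ℕ} (D : CAREData n ny nd nc) {k : ℕ}
  {P : Matrix (Fin n) (Fin n) ℝ}

theorem predCov_posSemidef (hQ : (D.Q k).PosSemidef) (hP : P.PosSemidef) :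
    (D.predCov k P).PosSemidef :=
  (hP.conj_transpose _).add hQ

/-- The covariance of the predicted output. -/
def outCov (k : ℕ) (P : Matrix (Fin n) (Fin n) ℝ) : Matrix (Fin ny) (Fin ny) ℝ :=
  D.C (k + 1) * D.predCov k P * (D.C (k + 1))ᵀ + D.R (k + 1)

theorem outCov_posDef (hQ : (D.Q k).PosSemidef) (hR : (D.R (k + 1)).PosDef)
    (hP : P.PosSemidef) : (D.outCov k P).PosDef :=
  Matrix.PosDef.posSemidef_add ((D.predCov_posSemidef hQ hP).conj_transpose _) hR

/-- The attack estimate is unbiased. -/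
theorem attackGain_mul (hM : IsUnit (D.attackInfo k P)) :
    D.attackGain k P * D.C (k + 1) * D.G k = 1 := by
  have h := Matrix.nonsing_inv_mul _ ((Matrix.isUnit_iff_isUnit_det _).mp hM)
  rw [← h, attackGain]
  nth_rewrite 3 [attackInfo]
  simp only [Matrix.mul_assoc]

theorem transpose_eq_of_posSemidef {m : Type*} [Fintype m] {S : Matrix m m ℝ}
    (hS : S.PosSemidef) : Sᵀ = S :=
  (posSemidef_iff_quadForm.mp hS).1

/-- M is the weighted least-squares gain for the output covariance, whose inverse is `R̃`;
unbiasedness `MCG = 1` collapses the product. -/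
theorem attackGain_cov (hQ : (D.Q k).PosSemidef) (hR : (D.R (k + 1)).PosDef)
    (hP : P.PosSemidef) (hM : IsUnit (D.attackInfo k P)) :
    D.attackGain k P * D.outCov k P * (D.attackGain k P)ᵀ = D.Pdu k P := by
  have hS := D.outCov_posDef hQ hR hP
  have h1 : D.Rtilde k P * D.outCov k P = 1 :=
    Matrix.nonsing_inv_mul _ ((Matrix.isUnit_iff_isUnit_det _).mp hS.isUnit)
  have h2 := congrArg Matrix.transpose (D.attackGain_mul hM)
  rw [Matrix.transpose_mul, Matrix.transpose_mul, Matrix.transpose_one] at h2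
  calc D.attackGain k P * D.outCov k P * (D.attackGain k P)ᵀ
      = (D.attackInfo k P)⁻¹ * (D.G k)ᵀ * (D.C (k + 1))ᵀ * (D.Rtilde k P * D.outCov k P)
        * (D.attackGain k P)ᵀ := by
        nth_rewrite 1 [attackGain]; simp only [Matrix.mul_assoc]
    _ = (D.attackInfo k P)⁻¹ * ((D.G k)ᵀ * ((D.C (k + 1))ᵀ * (D.attackGain k P)ᵀ)) := by
        rw [h1, Matrix.mul_one]; simp only [Matrix.mul_assoc]
    _ = D.Pdu k P := by rw [h2, Matrix.mul_one, Pdu]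

/-- The factor through which the predicted error enters the error after the time update. -/
noncomputable def timeFactor (k : ℕ) (P : Matrix (Fin n) (Fin n) ℝ) : Matrix (Fin n) (Fin n) ℝ :=
  1 - D.G k * D.attackGain k P * D.C (k + 1)

/-- The factor through which the predicted error enters the innovation, `(1 - C G M)`. -/
noncomputable def innovFactor (k : ℕ) (P : Matrix (Fin n) (Fin n) ℝ) : Matrix (Fin ny) (Fin ny) ℝ :=
  1 - D.C (k + 1) * D.G k * D.attackGain k P

/-- The error after the time update is `(1 - GMC)e - GMv`, with e the prediction error and v the
measurement noise. -/
theorem Pstar_eq (hQ : (D.Q k).PosSemidef) (hR : (D.R (k + 1)).PosDef)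
    (hP : P.PosSemidef) (hM : IsUnit (D.attackInfo k P)) :
    D.Pstar k P = D.timeFactor k P * D.predCov k P * (D.timeFactor k P)ᵀ
      + D.G k * D.attackGain k P * D.R (k + 1) * (D.G k * D.attackGain k P)ᵀ := by
  have hPt := transpose_eq_of_posSemidef hP
  rw [Pstar, ← D.attackGain_cov hQ hR hP hM, outCov, Pxd, timeFactor, predCov]
  simp only [Matrix.transpose_mul, Matrix.transpose_neg, Matrix.transpose_sub,
    Matrix.transpose_one, Matrix.transpose_transpose, Matrix.mul_add, Matrix.add_mul,
    Matrix.mul_sub, Matrix.sub_mul, Matrix.mul_neg, Matrix.neg_mul, Matrix.mul_one,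
    Matrix.one_mul, Matrix.mul_assoc, hPt]
  abel

/-- The innovation is `(1 - CGM)(Ce + v)`. As `CGM` is idempotent of rank `nd`, this covariance is
singular when `nd > 0`, whence the pseudoinverse in L. -/
theorem RtildeStar_eq (hQ : (D.Q k).PosSemidef) (hR : (D.R (k + 1)).PosDef)
    (hP : P.PosSemidef) (hM : IsUnit (D.attackInfo k P)) :
    D.RtildeStar k P = D.innovFactor k P * D.outCov k P * (D.innovFactor k P)ᵀ := by
  rw [RtildeStar, D.Pstar_eq hQ hR hP hM, innovFactor, outCov, timeFactor]
  simp only [Matrix.transpose_mul, Matrix.transpose_sub,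
    Matrix.transpose_one, Matrix.mul_add, Matrix.add_mul,
    Matrix.mul_sub, Matrix.sub_mul, Matrix.mul_one,
    Matrix.one_mul, Matrix.mul_assoc]
  abel

theorem crossCov_eq (hQ : (D.Q k).PosSemidef) (hR : (D.R (k + 1)).PosDef)
    (hP : P.PosSemidef) (hM : IsUnit (D.attackInfo k P)) :
    D.Pstar k P * (D.C (k + 1))ᵀ - D.G k * D.attackGain k P * D.R (k + 1) =
      (D.timeFactor k P * D.predCov k P * (D.C (k + 1))ᵀ
        - D.G k * D.attackGain k P * D.R (k + 1)) * (D.innovFactor k P)ᵀ := by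
  rw [D.Pstar_eq hQ hR hP hM, innovFactor, timeFactor]
  simp only [Matrix.transpose_mul, Matrix.transpose_sub,
    Matrix.transpose_one, Matrix.add_mul,
    Matrix.mul_sub, Matrix.sub_mul, Matrix.mul_one,
    Matrix.one_mul, Matrix.mul_assoc]
  abel

/-- The normal equations hold despite the singularity because the cross covariance also factors
through `(1 - CGM)ᵀ`. -/
theorem stateGain_mul_RtildeStar (hQ : (D.Q k).PosSemidef) (hR : (D.R (k + 1)).PosDef)
    (hP : P.PosSemidef) (hM : IsUnit (D.attackInfo k P)) :
    D.stateGain k P * D.RtildeStar k P =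
      D.Pstar k P * (D.C (k + 1))ᵀ - D.G k * D.attackGain k P * D.R (k + 1) := by
  rw [stateGain, D.crossCov_eq hQ hR hP hM, D.RtildeStar_eq hQ hR hP hM]
  exact mul_pinv_mul_conj (D.outCov_posDef hQ hR hP) _ _

/-- The factor of the predicted error in the error after the measurement update. -/
noncomputable def predFactor (k : ℕ) (P : Matrix (Fin n) (Fin n) ℝ) : Matrix (Fin n) (Fin n) ℝ :=
  (1 - D.stateGain k P * D.C (k + 1)) * D.timeFactor k P

/-- The factor of the measurement noise in the error after the measurement update. -/
noncomputable def noiseFactor (k : ℕ) (P : Matrix (Fin n) (Fin n) ℝ) : Matrix (Fin n) (Fin ny) ℝ :=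
  (1 - D.stateGain k P * D.C (k + 1)) * (D.G k * D.attackGain k P) + D.stateGain k P

/-- The updated error is `predFactor · e - noiseFactor · v` with e and v uncorrelated, so
semidefiniteness is visible. -/
theorem measUpdate_eq (hQ : (D.Q k).PosSemidef) (hR : (D.R (k + 1)).PosDef)
    (hP : P.PosSemidef) (hM : IsUnit (D.attackInfo k P)) :
    D.measUpdate k P = D.predFactor k P * D.predCov k P * (D.predFactor k P)ᵀ
      + D.noiseFactor k P * D.R (k + 1) * (D.noiseFactor k P)ᵀ := by
  rw [measUpdate, D.Pstar_eq hQ hR hP hM, predFactor, noiseFactor]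
  generalize 1 - D.stateGain k P * D.C (k + 1) = J
  simp only [Matrix.transpose_mul, Matrix.transpose_add, Matrix.mul_add, Matrix.add_mul,
    Matrix.mul_assoc]
  abel

theorem measUpdate_posSemidef (hQ : (D.Q k).PosSemidef) (hR : (D.R (k + 1)).PosDef)
    (hP : P.PosSemidef) (hM : IsUnit (D.attackInfo k P)) : (D.measUpdate k P).PosSemidef := by
  rw [D.measUpdate_eq hQ hR hP hM]
  exact ((D.predCov_posSemidef hQ hP).conj_transpose _).add (hR.posSemidef.conj_transpose _)

/-- The error after the measurement update is uncorrelated with the innovation. -/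
theorem factor_orthogonal (hQ : (D.Q k).PosSemidef) (hR : (D.R (k + 1)).PosDef)
    (hP : P.PosSemidef) (hM : IsUnit (D.attackInfo k P)) :
    D.predFactor k P * D.predCov k P * (D.C (k + 1) * D.timeFactor k P)ᵀ =
      D.noiseFactor k P * D.R (k + 1) * (D.innovFactor k P)ᵀ := by
  have h := D.stateGain_mul_RtildeStar hQ hR hP hM
  rw [RtildeStar, D.Pstar_eq hQ hR hP hM] at h
  rw [← sub_eq_zero]
  rw [← sub_eq_zero, ← neg_eq_zero] at h
  rw [← h, predFactor, noiseFactor, innovFactor]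
  simp only [Matrix.transpose_mul, Matrix.transpose_sub,
    Matrix.transpose_one, Matrix.mul_add, Matrix.add_mul,
    Matrix.mul_sub, Matrix.sub_mul, Matrix.mul_one,
    Matrix.one_mul, Matrix.mul_assoc]
  abel

/-- The measurement update is optimal among all linear updates. -/
theorem quadForm_measUpdate_le (hQ : (D.Q k).PosSemidef) (hR : (D.R (k + 1)).PosDef)
    (hP : P.PosSemidef) (hM : IsUnit (D.attackInfo k P)) (x : Fin n → ℝ) (u : Fin ny → ℝ) :
    quadForm (D.measUpdate k P) x ≤
      quadForm (D.predCov k P) ((D.timeFactor k P)ᵀ *ᵥ (x - (D.C (k + 1))ᵀ *ᵥ u)) +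
      quadForm (D.R (k + 1))
        ((D.G k * D.attackGain k P)ᵀ *ᵥ (x - (D.C (k + 1))ᵀ *ᵥ u) + u) := by
  rw [D.measUpdate_eq hQ hR hP hM]
  -- Shifting by `Lᵀx` cancels the optimal gain, leaving an arbitrary injection u.
  have h := quadForm_le_of_orthogonal (D.predCov_posSemidef hQ hP) hR.posSemidef
    (D.factor_orthogonal hQ hR hP hM) x (u - (D.stateGain k P)ᵀ *ᵥ x)
  refine h.trans (le_of_eq ?_)
  congr 2
  · rw [predFactor]
    simp only [Matrix.transpose_mul, Matrix.transpose_sub, Matrix.transpose_one,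
      Matrix.mulVec_sub, Matrix.mulVec_mulVec, Matrix.mul_sub, Matrix.sub_mulVec, Matrix.mul_one,
      Matrix.mul_assoc]
    abel
  · rw [noiseFactor, innovFactor]
    simp only [Matrix.transpose_mul, Matrix.transpose_sub, Matrix.transpose_one,
      Matrix.transpose_add, Matrix.add_mulVec, Matrix.mulVec_sub, Matrix.mulVec_mulVec,
      Matrix.sub_mulVec, Matrix.one_mulVec, Matrix.sub_mul,
      Matrix.one_mul, Matrix.mul_assoc]
    abel

end OneStep

end CAREData

theorem Matrix.PosDef.exists_pos_mul_sqNorm_le {m : Type*} [Fintype m] {P : Matrix m m ℝ}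
    (hP : P.PosDef) : ∃ a, 0 < a ∧ ∀ x, a * sqNorm x ≤ quadForm P x := by
  classical
  obtain ⟨a, ha, h⟩ : ∃ a, 0 < a ∧ ∀ i, a ≤ hP.1.eigenvalues i := by
    rcases isEmpty_or_nonempty m with hm | hm
    -- In dimension zero any positive constant will do; otherwise the least eigenvalue is used.
    · exact ⟨1, one_pos, fun i => hm.elim i⟩
    · obtain ⟨i, hi⟩ := Finite.exists_min hP.1.eigenvalues
      exact ⟨_, hP.eigenvalues_pos i, hi⟩
  refine ⟨a, ha, fun x => ?_⟩
  have hspec := hP.1.spectral_theorem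
  set U : Matrix m m ℝ := (hP.1.eigenvectorUnitary : Matrix m m ℝ) with hU
  have hUU : U * Uᵀ = 1 := by
    have := Matrix.mem_unitaryGroup_iff.mp hP.1.eigenvectorUnitary.2
    rwa [Matrix.star_eq_conjTranspose, Matrix.conjTranspose_eq_transpose_of_trivial] at this
  rw [Unitary.conjStarAlgAut_apply, Matrix.star_eq_conjTranspose,
    Matrix.conjTranspose_eq_transpose_of_trivial] at hspec
  have h1 : sqNorm x = sqNorm (Uᵀ *ᵥ x) := by
    have := quadForm_conj U (1 : Matrix m m ℝ) x
    simpa [quadForm, hUU, sqNorm] using this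
  rw [h1, hspec, quadForm_conj, sqNorm, quadForm, dotProduct, dotProduct, Finset.mul_sum]
  refine Finset.sum_le_sum fun i _ => ?_
  rw [Matrix.mulVec_diagonal]
  have := mul_le_mul_of_nonneg_right (h i) (mul_self_nonneg ((Uᵀ *ᵥ x) i))
  simp only [Function.comp_apply, RCLike.ofReal_real_eq_id, id]
  linarith

/-! ### Bounds along the covariance recursion -/

namespace CAREData

section Recursion

variable {n ny nd : ℕ} {nc : ℕ → ℕ} (D : CAREData n ny nd nc)

theorem Pxu_succ (k : ℕ) : D.Pxu (k + 1) = D.measUpdate k (D.Px k) := rfl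

theorem Pxu_posSemidef (hQ : ∀ k, (D.Q k).PosSemidef) (hR : ∀ k, (D.R k).PosDef)
    (hP₀ : D.P₀.PosSemidef) (hM : ∀ k, IsUnit (D.attackInfo k (D.Px k))) (k : ℕ) :
    (D.Pxu k).PosSemidef := by
  induction k with
  | zero => exact hP₀
  | succ k ih => exact D.measUpdate_posSemidef (hQ k) (hR _) (ih.conj_transpose _) (hM k)

theorem Px_posSemidef (hQ : ∀ k, (D.Q k).PosSemidef) (hR : ∀ k, (D.R k).PosDef)
    (hP₀ : D.P₀.PosSemidef) (hM : ∀ k, IsUnit (D.attackInfo k (D.Px k))) (k : ℕ) :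
    (D.Px k).PosSemidef :=
  (D.Pxu_posSemidef hQ hR hP₀ hM k).conj_transpose _

/-- This identity prevents both transposed factors from being small on the same vector; the lower
bound rests on it. -/
theorem predFactor_add (k : ℕ) (P : Matrix (Fin n) (Fin n) ℝ) :
    D.predFactor k P + D.noiseFactor k P * D.C (k + 1) = 1 := by
  rw [predFactor, noiseFactor, timeFactor]
  simp only [Matrix.mul_sub, Matrix.add_mul, Matrix.mul_one, Matrix.mul_assoc]
  abel

/-- Nondegenerate noise keeps the covariance away from zero, whatever the previous covariance. -/
theorem mul_sqNorm_le_quadForm_measUpdate {k : ℕ} {P : Matrix (Fin n) (Fin n) ℝ} {q r c : ℝ}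
    (hq : 0 < q) (hr : 0 < r) (hQ : (D.Q k).PosSemidef) (hR : (D.R (k + 1)).PosDef)
    (hP : P.PosSemidef) (hM : IsUnit (D.attackInfo k P)) (hC : ‖D.C (k + 1)‖ ≤ c)
    (hQq : ∀ x, q * sqNorm x ≤ quadForm (D.Q k) x)
    (hRr : ∀ x, r * sqNorm x ≤ quadForm (D.R (k + 1)) x) (x : Fin n → ℝ) :
    (2 / q + 2 * c ^ 2 / r)⁻¹ * sqNorm x ≤ quadForm (D.measUpdate k P) x := by
  rw [D.measUpdate_eq hQ hR hP hM, quadForm_add, quadForm_conj, quadForm_conj, predCov,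
    quadForm_add]
  set α := (D.predFactor k P)ᵀ *ᵥ x with hα
  set β := (D.noiseFactor k P)ᵀ *ᵥ x with hβ
  have hx : x = α + (D.C (k + 1))ᵀ *ᵥ β := by
    rw [hα, hβ, Matrix.mulVec_mulVec, ← Matrix.transpose_mul, ← Matrix.add_mulVec,
      ← Matrix.transpose_add, D.predFactor_add, Matrix.transpose_one, Matrix.one_mulVec]
  have h1 : sqNorm x ≤ 2 * sqNorm α + 2 * (c ^ 2 * sqNorm β) := by
    rw [hx]
    refine (sqNorm_add_le _ _).trans ?_
    have := sqNorm_transpose_mulVec_le hC β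
    linarith
  have h2 := (posSemidef_iff_quadForm.mp (hP.conj_transpose (D.A k))).2 α
  have h3 := hQq α
  have h4 := hRr β
  have hα0 := sqNorm_nonneg α
  have hβ0 := sqNorm_nonneg β
  rw [inv_mul_le_iff₀ (by positivity)]
  have h5 : 2 * sqNorm α + 2 * (c ^ 2 * sqNorm β) ≤
      (2 / q + 2 * c ^ 2 / r) * (q * sqNorm α + r * sqNorm β) := by
    have e : (2 / q + 2 * c ^ 2 / r) * (q * sqNorm α + r * sqNorm β) =
        2 * sqNorm α + 2 * (c ^ 2 * sqNorm β) +
          (2 / q * (r * sqNorm β) + 2 * c ^ 2 / r * (q * sqNorm α)) := by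
      field_simp
      ring
    rw [e]
    exact le_add_of_nonneg_right (by positivity)
  refine (h1.trans h5).trans (mul_le_mul_of_nonneg_left ?_ (by positivity))
  linarith

/-- One step of the recursion along an arbitrary output injection of the pair `(C, Ã)`. -/
theorem exists_step_bound {c g μ q r : ℝ}
    (hQ : ∀ k, (D.Q k).PosSemidef) (hR : ∀ k, (D.R k).PosDef)
    (hP₀ : D.P₀.PosSemidef) (hM : ∀ k, IsUnit (D.attackInfo k (D.Px k)))
    (hCc : ∀ k, ‖D.C k‖ ≤ c) (hGg : ∀ k, ‖D.G k‖ ≤ g) (hMm : ∀ k, ‖D.M k‖ ≤ μ)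
    (hQq : ∀ k, ‖D.Q k‖ ≤ q) (hRr : ∀ k, ‖D.R k‖ ≤ r) :
    ∃ K, 0 ≤ K ∧ ∀ k x u, quadForm (D.Pxu (k + 1)) x ≤
      quadForm (D.Pxu k) ((D.Atilde k)ᵀ *ᵥ (x - (D.C (k + 1))ᵀ *ᵥ u)) +
        K * (sqNorm x + sqNorm u) := by
  have hq0 : 0 ≤ q := (norm_nonneg _).trans (hQq 0)
  have hr0 : 0 ≤ r := (norm_nonneg _).trans (hRr 0)
  set b : ℝ := (g * μ) ^ 2 with hb
  set a₁ : ℝ := 2 * b + 2 with ha₁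
  set a₂ : ℝ := 2 + 2 * c ^ 2 * a₁ with ha₂
  set a₃ : ℝ := 2 * a₂ + 2 * c ^ 2 * (b * a₂) with ha₃
  set a₄ : ℝ := 2 * (b * a₂) + 2 * a₁ with ha₄
  refine ⟨q * a₃ + r * a₄, by positivity, fun k x u => ?_⟩
  set N := D.G k * D.M k with hN
  set X := D.C (k + 1) * D.G k * D.M k with hXdef
  have hXN : X = D.C (k + 1) * N := by rw [hXdef, hN, Matrix.mul_assoc]
  have hX : X * X = X := by
    have := D.attackGain_mul (hM k)
    calc X * X = D.C (k + 1) * D.G k * (D.M k * D.C (k + 1) * D.G k) * D.M k := by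
          rw [hXdef]; simp only [Matrix.mul_assoc]
      _ = X := by rw [M, this, Matrix.mul_one, hXdef, M]
  have hNb : ∀ z, sqNorm (Nᵀ *ᵥ z) ≤ b * sqNorm z := by
    refine fun z => sqNorm_transpose_mulVec_le ((Matrix.l2_opNorm_mul _ _).trans ?_) z
    exact mul_le_mul (hGg k) (hMm k) (norm_nonneg _) ((norm_nonneg _).trans (hGg k))
  -- This injection is read off from `(1 - N X† C)ᵀ(x - Cᵀu) = x - Cᵀv`, using `CN = X`; it makes
  -- `Ãᵀ(x - Cᵀu)` appear.
  set v := (pinv X)ᵀ *ᵥ Nᵀ *ᵥ x + (1 - X * pinv X)ᵀ *ᵥ u with hv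
  set z := x - (D.C (k + 1))ᵀ *ᵥ v with hz
  set S := sqNorm x + sqNorm u with hS
  have hx0 := sqNorm_nonneg x
  have hu0 := sqNorm_nonneg u
  have hv1 : sqNorm v ≤ a₁ * S := by
    refine (sqNorm_add_le _ _).trans ?_
    have h1 := (sqNorm_pinv_transpose_mulVec_le hX (Nᵀ *ᵥ x)).trans (hNb x)
    have h2 := sqNorm_one_sub_mul_pinv_transpose_mulVec_le X u
    have h3 : 0 ≤ b * sqNorm u := by positivity
    rw [ha₁, hS]
    linarith
  have hz1 : sqNorm z ≤ a₂ * S := by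
    refine (sqNorm_sub_le _ _).trans ?_
    have h1 := sqNorm_transpose_mulVec_le (hCc (k + 1)) v
    have h2 := mul_le_mul_of_nonneg_left hv1 (sq_nonneg c)
    rw [ha₂]
    linarith
  have hNz : sqNorm (Nᵀ *ᵥ z) ≤ b * a₂ * S := by
    refine (hNb z).trans ?_
    rw [mul_assoc]
    exact mul_le_mul_of_nonneg_left hz1 (sq_nonneg _)
  have hT : sqNorm ((D.timeFactor k (D.Px k))ᵀ *ᵥ z) ≤ a₃ * S := by
    have e : (D.timeFactor k (D.Px k))ᵀ *ᵥ z = z - (D.C (k + 1))ᵀ *ᵥ Nᵀ *ᵥ z := by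
      rw [timeFactor, hN, M, Matrix.transpose_sub, Matrix.transpose_one, Matrix.sub_mulVec,
        Matrix.one_mulVec, Matrix.transpose_mul _ (D.C (k + 1)), Matrix.mulVec_mulVec]
    rw [e]
    refine (sqNorm_sub_le _ _).trans ?_
    have h1 := sqNorm_transpose_mulVec_le (hCc (k + 1)) (Nᵀ *ᵥ z)
    have h2 := mul_le_mul_of_nonneg_left hNz (sq_nonneg c)
    rw [ha₃]
    linarith
  have hB : sqNorm (Nᵀ *ᵥ z + v) ≤ a₄ * S := by
    refine (sqNorm_add_le _ _).trans ?_
    rw [ha₄]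
    linarith
  have hA : (D.Atilde k)ᵀ *ᵥ (x - (D.C (k + 1))ᵀ *ᵥ u) =
      (D.GammaBar k)ᵀ *ᵥ (D.A k)ᵀ *ᵥ (D.timeFactor k (D.Px k))ᵀ *ᵥ z := by
    have e : (1 - N * pinv X * D.C (k + 1))ᵀ *ᵥ (x - (D.C (k + 1))ᵀ *ᵥ u) = z := by
      rw [hz, hv, hXN]
      simp only [Matrix.transpose_mul, Matrix.transpose_sub, Matrix.transpose_one,
        Matrix.mulVec_sub, Matrix.mulVec_add, Matrix.sub_mulVec, Matrix.one_mulVec,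
        Matrix.mulVec_mulVec, Matrix.sub_mul, Matrix.one_mul, Matrix.mul_assoc]
      abel
    rw [← e, Atilde, Abar, timeFactor, ← M]
    simp only [Matrix.transpose_mul, Matrix.mulVec_mulVec, Matrix.mul_assoc, hN, hXdef]
  have hstep := D.quadForm_measUpdate_le (hQ k) (hR _) (D.Px_posSemidef hQ hR hP₀ hM k) (hM k) x v
  rw [← hz, ← M, ← hN, predCov, quadForm_add, quadForm_conj, Px, quadForm_conj, ← Px, ← hA]
    at hstep
  have h1 := (quadForm_le (hQq k) ((D.timeFactor k (D.Px k))ᵀ *ᵥ z)).trans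
    (mul_le_mul_of_nonneg_left hT hq0)
  have h2 := (quadForm_le (hRr (k + 1)) (Nᵀ *ᵥ z + v)).trans
    (mul_le_mul_of_nonneg_left hB hr0)
  rw [Pxu_succ]
  linarith

end Recursion

end CAREData

/-! ### Loewner bounds and the conclusion -/

theorem posSemidef_sub_smul_one_iff {m : Type*} [Fintype m] [DecidableEq m] {P : Matrix m m ℝ}
    (hP : Pᵀ = P) {a : ℝ} :
    (P - a • (1 : Matrix m m ℝ)).PosSemidef ↔ ∀ x, a * sqNorm x ≤ quadForm P x := by
  rw [posSemidef_iff_quadForm]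
  simp only [quadForm_sub, quadForm_smul_one, sub_nonneg, Matrix.transpose_sub,
    Matrix.transpose_smul, Matrix.transpose_one, hP, true_and]

theorem posSemidef_smul_one_sub_iff {m : Type*} [Fintype m] [DecidableEq m] {P : Matrix m m ℝ}
    (hP : Pᵀ = P) {a : ℝ} :
    (a • (1 : Matrix m m ℝ) - P).PosSemidef ↔ ∀ x, quadForm P x ≤ a * sqNorm x := by
  rw [posSemidef_iff_quadForm]
  simp only [quadForm_sub, quadForm_smul_one, sub_nonneg, Matrix.transpose_sub,
    Matrix.transpose_smul, Matrix.transpose_one, hP, true_and]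

theorem mainTheorem4 {n ny nd : ℕ} {nc : ℕ → ℕ} (D : CAREData n ny nd nc)
    (hQ : ∀ k, (D.Q k).PosSemidef)
    (hR : ∀ k, (D.R k).PosDef)
    (hP₀ : D.P₀.PosSemidef)
    (hAbdd : ∃ a : ℝ, ∀ k, ‖D.A k‖ ≤ a)
    (hCbdd : ∃ c : ℝ, ∀ k, ‖D.C k‖ ≤ c)
    (hGbdd : ∃ g : ℝ, ∀ k, ‖D.G k‖ ≤ g)
    (hMbdd : ∃ m : ℝ, ∀ k, ‖D.M k‖ ≤ m)
    (hQbdd : ∃ q : ℝ, ∀ k, ‖D.Q k‖ ≤ q)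
    (hRbdd : ∃ r : ℝ, ∀ k, ‖D.R k‖ ≤ r)
    (hMinv : ∀ k, IsUnit (D.attackInfo k (D.Px k)))
    (hBinv : ∀ k, IsUnit (D.Bbar k * D.Pxu k * (D.Bbar k)ᵀ))
    (hdet : UniformlyDetectable D.C D.Atilde) :
    ∃ pl pu : ℝ, 0 ≤ pl ∧ 0 ≤ pu ∧
      (∀ k, (D.Pxu k - pl • (1 : Matrix (Fin n) (Fin n) ℝ)).PosSemidef ∧
        (pu • (1 : Matrix (Fin n) (Fin n) ℝ) - D.Pxu k).PosSemidef) ∧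
      ((∃ q : ℝ, 0 < q ∧ ∀ k, (D.Q k - q • (1 : Matrix (Fin n) (Fin n) ℝ)).PosSemidef) →
        (∃ r : ℝ, 0 < r ∧ ∀ k, (D.R k - r • (1 : Matrix (Fin ny) (Fin ny) ℝ)).PosSemidef) →
        D.P₀.PosDef → 0 < pl) := by
  obtain ⟨c, hc⟩ := hCbdd
  obtain ⟨g, hg⟩ := hGbdd
  obtain ⟨μ, hμ⟩ := hMbdd
  obtain ⟨q', hq'⟩ := hQbdd
  obtain ⟨r', hr'⟩ := hRbdd
  have hpsd := D.Pxu_posSemidef hQ hR hP₀ hMinv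
  have hsymm := fun k => CAREData.transpose_eq_of_posSemidef (hpsd k)
  obtain ⟨K, hK, hstep⟩ := D.exists_step_bound hQ hR hP₀ hMinv hc hg hμ hq' hr'
  obtain ⟨pu, hpu, hupper⟩ := hdet.exists_cost_bound (V := fun k => quadForm (D.Pxu k)) hK hstep
    (quadForm_le le_rfl)
  suffices h : ∃ pl : ℝ, 0 ≤ pl ∧ (∀ k x, pl * sqNorm x ≤ quadForm (D.Pxu k) x) ∧
      ((∃ q : ℝ, 0 < q ∧ ∀ k, (D.Q k - q • (1 : Matrix (Fin n) (Fin n) ℝ)).PosSemidef) →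
        (∃ r : ℝ, 0 < r ∧ ∀ k, (D.R k - r • (1 : Matrix (Fin ny) (Fin ny) ℝ)).PosSemidef) →
        D.P₀.PosDef → 0 < pl) by
    obtain ⟨pl, hpl, hlower, hpos⟩ := h
    exact ⟨pl, pu, hpl, hpu, fun k => ⟨(posSemidef_sub_smul_one_iff (hsymm k)).mpr (hlower k),
      (posSemidef_smul_one_sub_iff (hsymm k)).mpr (hupper k)⟩, hpos⟩
  -- The lower constant is chosen before the nondegeneracy assumptions are introduced, hence the
  -- case split; zero serves when they fail.
  by_cases hnd : (∃ q : ℝ, 0 < q ∧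
        ∀ k, (D.Q k - q • (1 : Matrix (Fin n) (Fin n) ℝ)).PosSemidef) ∧
      (∃ r : ℝ, 0 < r ∧ ∀ k, (D.R k - r • (1 : Matrix (Fin ny) (Fin ny) ℝ)).PosSemidef) ∧
      D.P₀.PosDef
  · obtain ⟨⟨q, hq, hQq⟩, ⟨r, hr, hRr⟩, hP₀pos⟩ := hnd
    obtain ⟨p₀, hp₀, hinit⟩ := hP₀pos.exists_pos_mul_sqNorm_le
    have hpos : 0 < min p₀ (2 / q + 2 * c ^ 2 / r)⁻¹ := lt_min hp₀ (by positivity)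
    refine ⟨_, hpos.le, fun k x => ?_, fun _ _ _ => hpos⟩
    cases k with
    | zero =>
      exact (mul_le_mul_of_nonneg_right (min_le_left _ _) (sqNorm_nonneg x)).trans (hinit x)
    | succ k =>
      refine (mul_le_mul_of_nonneg_right (min_le_right _ _) (sqNorm_nonneg x)).trans ?_
      exact D.mul_sqNorm_le_quadForm_measUpdate hq hr (hQ k) (hR _)
        (D.Px_posSemidef hQ hR hP₀ hMinv k) (hMinv k) (hc _)
        ((posSemidef_sub_smul_one_iff (CAREData.transpose_eq_of_posSemidef (hQ k))).mp (hQq k))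
        ((posSemidef_sub_smul_one_iff (CAREData.transpose_eq_of_posSemidef
          (hR (k + 1)).posSemidef)).mp (hRr (k + 1))) x
  · refine ⟨0, le_rfl, fun k x => ?_, fun h1 h2 h3 => absurd ⟨h1, h2, h3⟩ hnd⟩
    rw [zero_mul]
    exact (posSemidef_iff_quadForm.mp (hpsd k)).2 x
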